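/- For $\mathcal{E}\in(0,1)$ let $$u_0(x)=\sqrt{1-\mathcal{E}}\;\mathrm{sn}\!\left(x\sqrt{\tfrac{1+\mathcal{E}}{2}},\,k\right),\qquad k=\sqrt{\tfrac{1-\mathcal{E}}{1+\mathcal{E}}},$$ where $\mathrm{sn}(\cdot,k)$ is the Jacobi elliptic function of modulus $k$; this is a real periodic solution of $u_0''+(1-u_0^2)u_0=0$. Consider the (formal) functionals of $\psi$ $$E(\psi)=\int\Big[|\psi_x|^2+\tfrac12(1-|\psi|^2)^2\Big]dx,\qquad Q(\psi)=\int|\psi|^2\,dx,$$ $$R(\psi)=\int\Big[|\psi_{xx}|^2+3|\psi|^2|\psi_x|^2+\tfrac12(\bar\psi\psi_x+\psi\bar\psi_x)^2+\tfrac12|\psi|^6\Big]dx,$$ $$S(\psi)=R(\psi)-\tfrac12(3-\mathcal{E}^2)Q(\psi),\qquad \Lambda_c(\psi)=S(\psi)-cE(\psi)\quad(c\in\mathbb{R}).$$ Let $\mathcal{L}_c(\psi,\psi_x,\psi_{xx})$ be the integrand of $\Lambda_c$. The second variation of $\Lambda_c$ at $u_0$ in the direction $w\in H^2(\mathbb{R};\mathbb{C})$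 is $$\langle\Lambda_c''(u_0)w,w\rangle=\int_{\mathbb{R}}\frac{d^2}{d\varepsilon^2}\Big|_{\varepsilon=0}\mathcal{L}_c\big(u_0+\varepsilon w,\;u_0'+\varepsilon w_x,\;u_0''+\varepsilon w_{xx}\big)\,dx .$$ **Proposition.** There exists $\mathcal{E}_0\in(0,1)$ such that for every $\mathcal{E}\in(\mathcal{E}_0,1)$ there exist $c_-=c_-(\mathcal{E})$ and $c_+=c_+(\mathcal{E})$ with $1<c_-<2<c_+<3$ such that, for every $c\in(c_-,c_+)$ and every $w\in H^2(\mathbb{R};\mathbb{C})$, the integral defining $\langle\Lambda_c''(u_0)w,w\rangle$ converges absolutely and $$\langle\Lambda_c''(u_0)w,w\rangle\ge 0 .$$ Moreover, these values can be chosen so that $$c_\pm(\mathcal{E})=2\pm\sqrt{2(1-\mathcal{E})}+O(1-\mathcal{E})\qquad\text{as }\mathcal{E}\to1^- .$$ -/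

import Mathlib

noncomputable section

namespace CnoidalNLS

open MeasureTheory
open scoped ComplexConjugate ContDiff

/-- Incomplete elliptic integral of the first kind
`F(φ, k) = ∫₀^φ dθ / √(1 - k² sin² θ)`. -/
def ellipticF (k φ : ℝ) : ℝ :=
  ∫ θ in (0 : ℝ)..φ, 1 / Real.sqrt (1 - k ^ 2 * Real.sin θ ^ 2)

/-- Jacobi amplitude `am(ξ, k)`: the inverse function of `φ ↦ F(φ, k)`, which is an increasing
bijection of `ℝ` when `|k| < 1`. -/
def jacobiAm (ξ k : ℝ) : ℝ := Function.invFun (ellipticF k) ξ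

/-- Jacobi elliptic function `sn(ξ, k) = sin (am(ξ, k))`. -/
def jacobiSn (ξ k : ℝ) : ℝ := Real.sin (jacobiAm ξ k)

/-- The cnoidal wave profile
`u₀(x) = √(1 - 𝓔) sn(x √((1 + 𝓔)/2), √((1 - 𝓔)/(1 + 𝓔)))`. -/
def profile (𝓔 x : ℝ) : ℝ :=
  Real.sqrt (1 - 𝓔) *
    jacobiSn (x * Real.sqrt ((1 + 𝓔) / 2)) (Real.sqrt ((1 - 𝓔) / (1 + 𝓔)))

/-- Density of the energy `E`, as a function of the values `p = ψ`, `q = ψ_x`. -/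
def energyDensity (p q : ℂ) : ℝ := ‖q‖ ^ 2 + 1 / 2 * (1 - ‖p‖ ^ 2) ^ 2

/-- Density of the charge `Q`. -/
def chargeDensity (p : ℂ) : ℝ := ‖p‖ ^ 2

/-- Density of the higher-order functional `R`, as a function of `p = ψ`, `q = ψ_x`, `r = ψ_xx`.
The number `conj p * q + p * conj q` is real. -/
def higherDensity (p q r : ℂ) : ℝ :=
  ‖r‖ ^ 2 + 3 * ‖p‖ ^ 2 * ‖q‖ ^ 2 + 1 / 2 * (conj p * q + p * conj q).re ^ 2 + 1 / 2 * ‖p‖ ^ 6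

/-- Density of `S = R - (3 - 𝓔²)/2 Q`. -/
def actionDensity (𝓔 : ℝ) (p q r : ℂ) : ℝ :=
  higherDensity p q r - 1 / 2 * (3 - 𝓔 ^ 2) * chargeDensity p

/-- Density of `Λ_c = S - c E`. -/
def lambdaDensity (𝓔 c : ℝ) (p q r : ℂ) : ℝ :=
  actionDensity 𝓔 p q r - c * energyDensity p q

/-- `w'` is the weak derivative of `w` on `ℝ`. -/
def HasWeakDeriv (w w' : ℝ → ℂ) : Prop :=
  ∀ φ : ℝ → ℝ, ContDiff ℝ ∞ φ → HasCompactSupport φ →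
    ∫ x, deriv φ x • w x = -∫ x, φ x • w' x

/-- `w` belongs to the Sobolev space `H²(ℝ; ℂ)`, and its first and second weak derivatives
are `w₁` and `w₂`. -/
structure IsH2 (w w₁ w₂ : ℝ → ℂ) : Prop where
  memLp : MemLp w 2 volume
  memLp_fst : MemLp w₁ 2 volume
  memLp_snd : MemLp w₂ 2 volume
  weak_fst : HasWeakDeriv w w₁
  weak_snd : HasWeakDeriv w₁ w₂

/-- The second derivative at `ε = 0` of the density of `Λ_c` along `u₀ + ε w`, at the point `x`,
where `w₁`, `w₂` are the first and second derivatives of `w`. -/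
def secondVariationDensity (𝓔 c : ℝ) (w w₁ w₂ : ℝ → ℂ) (x : ℝ) : ℝ :=
  iteratedDeriv 2 (fun ε : ℝ => lambdaDensity 𝓔 c
    (((profile 𝓔 x : ℝ) : ℂ) + ε • w x)
    (((deriv (profile 𝓔) x : ℝ) : ℂ) + ε • w₁ x)
    (((deriv (deriv (profile 𝓔)) x : ℝ) : ℂ) + ε • w₂ x)) 0

/-- The second variation `⟨Λ_c''(u₀) w, w⟩` for perturbations on the whole line. The functional
itself diverges at the periodic profile `u₀` on the line, so the differentiation in `ε` is carried
out under the integral sign. -/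
def secondVariation (𝓔 c : ℝ) (w w₁ w₂ : ℝ → ℂ) : ℝ :=
  ∫ x, secondVariationDensity 𝓔 c w w₁ w₂ x

end CnoidalNLS

end

/-! The second variation splits into quadratic forms in the real part u and the imaginary part v of
w. Each becomes pointwise nonnegative once a suitable total derivative of a quadratic expression in
the function and its first derivative is subtracted. Write U for the profile, r = √(1 - 𝓔), c = 2 +
r d and D = U'² - U U''.

For v, take f = -v'' - (1 - U²) v and g = U v' - U' v; both vanish on the phase mode v = U, and g' =
-U f. At c = 2 the density is f² + g² modulo derivatives. The remainder -r d (v'² - (1 - U²) v²) is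
-r d g²/U² modulo derivatives; adding the derivative of -r d U' g²/(U D) removes the pole at the
zeros of U and leaves only f g and g² terms. One freedom is left: l (U U' g²)' = l ((U'² - (1 - U²)
U²) g² - 2 U² U' f g). The result is f² + 2 q f g + m g², and q² ≤ m suffices. For u the same works
with F and G vanishing on the translation mode u = U'.

For small r, U² = r² Y and U'² ≈ r² (1 - Y) with 0 ≤ Y ≤ 1. With l = d²/(2 r²) the leading part of
q² ≤ m loses its dependence on Y and reads d² ≤ 2 in both cases. This gives the half-width √(2(1 -
𝓔)); the errors are O(r) in d², hence O(1 - 𝓔) in c. The carriers are `imag_discriminant`,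
`real_discriminant` and `integral_nonneg_of_null_lagrangian`. -/

noncomputable section

namespace CnoidalNLS

open MeasureTheory Set Filter Topology
open scoped ComplexConjugate ContDiff

/-! ### Weak derivatives and absolutely continuous representatives -/

/-- A smooth compactly supported function of zero mean has a smooth compactly supported
primitive. -/
theorem exists_compactSupport_primitive {χ : ℝ → ℝ} (hχ : ContDiff ℝ ∞ χ)
    (hc : HasCompactSupport χ) (h0 : ∫ x, χ x = 0) :
    ∃ Φ : ℝ → ℝ, ContDiff ℝ ∞ Φ ∧ HasCompactSupport Φ ∧ deriv Φ = χ := by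
  obtain ⟨M, hM⟩ := hc.isCompact.isBounded.subset_closedBall 0
  have hz : ∀ x, M < |x| → χ x = 0 := by
    intro x hx
    by_contra h
    have := hM (subset_tsupport _ h)
    rw [Metric.mem_closedBall, dist_zero_right, Real.norm_eq_abs] at this
    linarith
  have hd : ∀ x, HasDerivAt (fun x => ∫ t in (-(|M| + 1))..x, χ t) (χ x) x := fun x =>
    (hχ.continuous.integral_hasStrictDerivAt _ x).hasDerivAt
  have hder : deriv (fun x => ∫ t in (-(|M| + 1))..x, χ t) = χ := funext fun x => (hd x).deriv
  refine ⟨fun x => ∫ t in (-(|M| + 1))..x, χ t, ?_, ?_, hder⟩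
  · rw [contDiff_infty_iff_deriv, hder]
    exact ⟨fun x => (hd x).differentiableAt, hχ⟩
  · refine HasCompactSupport.of_support_subset_isCompact
      (isCompact_Icc (a := -(|M| + 1)) (b := |M| + 1)) ?_
    intro x hx
    by_contra hx'
    apply hx
    have hMM := le_abs_self M
    have hM0 := abs_nonneg M
    rw [mem_Icc, not_and_or, not_le, not_le] at hx'
    rcases hx' with hx' | hx'
    · refine (intervalIntegral.integral_congr (g := fun _ => (0 : ℝ)) ?_).trans (by simp)
      intro t ht
      rw [uIcc_of_ge hx'.le] at ht
      apply hz
      rw [lt_abs]; right; linarith [ht.2]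
    · show ∫ t in (-(|M| + 1))..x, χ t = 0
      rw [intervalIntegral.integral_eq_integral_of_support_subset, h0]
      intro t ht
      by_contra ht'
      apply ht
      rw [mem_Ioc, not_and_or, not_lt, not_le] at ht'
      apply hz
      rw [lt_abs]
      rcases ht' with h | h
      · right; linarith
      · left; linarith

/-- A locally integrable function with vanishing weak derivative is almost everywhere constant. -/
theorem ae_const_of_weakDeriv_zero {f : ℝ → ℝ} (hf : LocallyIntegrable f)
    (h : ∀ φ : ℝ → ℝ, ContDiff ℝ ∞ φ → HasCompactSupport φ → ∫ x, deriv φ x * f x = 0) :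
    ∃ C : ℝ, ∀ᵐ x, f x = C := by
  let b : ContDiffBump (0 : ℝ) := ⟨1, 2, by norm_num, by norm_num⟩
  set ψ : ℝ → ℝ := b.normed volume with hψ
  have hψs : ContDiff ℝ ∞ ψ := b.contDiff_normed
  have hψc : HasCompactSupport ψ := b.hasCompactSupport_normed
  have hψ1 : ∫ x, ψ x = 1 := b.integral_normed
  -- Each test function φ differs from (∫ φ) ψ by a function of zero mean, that is, by the
  -- derivative of a test function, which f annihilates. Hence ∫ φ f = (∫ φ)(∫ ψ f).
  refine ⟨∫ x, ψ x * f x, ?_⟩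
  refine ae_eq_of_integral_contDiff_smul_eq hf (locallyIntegrable_const _) ?_
  intro φ hφ hφc
  have hiφ : Integrable φ := hφ.continuous.integrable_of_hasCompactSupport hφc
  have hiψ : Integrable ψ := hψs.continuous.integrable_of_hasCompactSupport hψc
  obtain ⟨Φ, hΦ, hΦc, hΦd⟩ := exists_compactSupport_primitive
    (χ := fun x => φ x - (∫ y, φ y) * ψ x) (hφ.sub (contDiff_const.mul hψs))
    (hφc.sub (hψc.mul_left)) (by
      rw [integral_sub hiφ (hiψ.const_mul _), integral_const_mul, hψ1]; ring)
  have h1 := h Φ hΦ hΦc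
  rw [hΦd] at h1
  have hI1 : Integrable fun x => φ x * f x :=
    hf.integrable_smul_left_of_hasCompactSupport hφ.continuous hφc
  have hI2 : Integrable fun x => ψ x * f x :=
    hf.integrable_smul_left_of_hasCompactSupport hψs.continuous hψc
  have h2 : ∫ x, (φ x * f x - (∫ y, φ y) * (ψ x * f x)) = 0 := by
    rw [← h1]; congr 1; ext x; ring
  rw [integral_sub hI1 (hI2.const_mul _), integral_const_mul] at h2
  simp only [smul_eq_mul]
  rw [integral_mul_const]
  linarith

/-- Two functions in `L²`, the second of which is the weak derivative of the first. -/
structure IsH1 (f g : ℝ → ℝ) : Prop where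
  memLp : MemLp f 2 volume
  memLp_deriv : MemLp g 2 volume
  weak : ∀ φ : ℝ → ℝ, ContDiff ℝ ∞ φ → HasCompactSupport φ →
    ∫ x, deriv φ x * f x = -∫ x, φ x * g x

/-- Functions in `H¹(ℝ)` have an absolutely continuous representative, whose derivative is almost
everywhere the weak derivative. -/
theorem IsH1.exists_absolutelyContinuous {f f' : ℝ → ℝ} (h : IsH1 f f') :
    ∃ F : ℝ → ℝ, (∀ a b, AbsolutelyContinuousOnInterval F a b) ∧ (∀ᵐ x, F x = f x) ∧
      ∀ᵐ x, HasDerivAt F (f' x) x := by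
  have hlf : LocallyIntegrable f := h.memLp.locallyIntegrable (by norm_num)
  have hlf' : LocallyIntegrable f' := h.memLp_deriv.locallyIntegrable (by norm_num)
  have hii : ∀ a b, IntervalIntegrable f' volume a b := fun a b =>
    intervalIntegrable_iff.2
      ((hlf'.integrableOn_isCompact isCompact_uIcc).mono_set uIoc_subset_uIcc)
  have hderiv : ∀ᵐ x, HasDerivAt (fun x => ∫ t in (0 : ℝ)..x, f' t) (f' x) x := by
    filter_upwards [_root_.LocallyIntegrable.ae_hasDerivAt_integral hlf'] with x hx using hx 0
  have hac : ∀ a b, AbsolutelyContinuousOnInterval (fun x => ∫ t in (0 : ℝ)..x, f' t) a b := by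
    intro a b
    have := (hii (-(|a| + |b|)) (|a| + |b|)).absolutelyContinuousOnInterval_intervalIntegral
      (c := 0) (by
        rw [uIcc_of_le (by linarith [abs_nonneg a, abs_nonneg b])]
        constructor <;> linarith [abs_nonneg a, abs_nonneg b])
    refine this.mono ?_
    rw [uIcc_of_le (a := -(|a| + |b|)) (by linarith [abs_nonneg a, abs_nonneg b])]
    refine uIcc_subset_Icc ⟨?_, ?_⟩ ⟨?_, ?_⟩ <;>
      linarith [abs_nonneg a, abs_nonneg b, le_abs_self a, le_abs_self b, neg_abs_le a,
        neg_abs_le b]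
  have hcont : Continuous (fun x => ∫ t in (0 : ℝ)..x, f' t) :=
    intervalIntegral.continuous_primitive (fun a b => hii a b) 0
  obtain ⟨C, hC⟩ := ae_const_of_weakDeriv_zero (f := fun x => f x - ∫ t in (0 : ℝ)..x, f' t)
    (hlf.sub hcont.locallyIntegrable) (by
      intro φ hφ hφc
      have hφ'c : Continuous (deriv φ) := hφ.continuous_deriv (by simp)
      have hφ's : HasCompactSupport (deriv φ) := hφc.deriv
      obtain ⟨M, hM⟩ := hφc.isCompact.isBounded.subset_closedBall 0
      have hz : ∀ x, x ∈ tsupport φ → |x| ≤ |M| := by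
        intro x hx
        have := hM hx
        rw [Metric.mem_closedBall, dist_zero_right, Real.norm_eq_abs] at this
        exact this.trans (le_abs_self M)
      have hsub : tsupport φ ⊆ Ioc (-(|M| + 1)) (|M| + 1) := by
        intro x hx
        have := abs_le.1 (hz x hx)
        exact ⟨by linarith [this.1], by linarith [this.2]⟩
      have hend : ∀ x, |M| < |x| → φ x = 0 := fun x hx => by
        by_contra hne
        exact absurd (hz x (subset_tsupport _ hne)) (not_le.2 hx)
      -- The interval extends past the support of φ, so the boundary terms vanish and both integrals
      -- extend to the whole line.
      have hparts := AbsolutelyContinuousOnInterval.integral_mul_deriv_eq_deriv_mul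
        ((hφ.of_le (m := 1) (by simp)).contDiffOn.absolutelyContinuousOnInterval)
        (hac (-(|M| + 1)) (|M| + 1))
      have e1 : φ (|M| + 1) = 0 := hend _ (by
        rw [abs_of_nonneg (a := |M| + 1) (by positivity)]; linarith)
      have e2 : φ (-(|M| + 1)) = 0 := hend _ (by
        rw [abs_neg, abs_of_nonneg (a := |M| + 1) (by positivity)]; linarith)
      rw [e1, e2, zero_mul, zero_mul, sub_zero, zero_sub,
        intervalIntegral.integral_eq_integral_of_support_subset,
        intervalIntegral.integral_eq_integral_of_support_subset] at hparts
      · have e3 : ∫ x, φ x * deriv (fun x => ∫ t in (0 : ℝ)..x, f' t) x = ∫ x, φ x * f' x := by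
          refine integral_congr_ae ?_
          filter_upwards [hderiv] with x hx
          rw [hx.deriv]
        rw [e3] at hparts
        simp only [mul_sub]
        rw [integral_sub, h.weak φ hφ hφc, hparts]
        · ring
        · exact hlf.integrable_smul_left_of_hasCompactSupport hφ'c hφ's
        · exact hcont.locallyIntegrable.integrable_smul_left_of_hasCompactSupport hφ'c hφ's
      · refine (Function.support_mul_subset_left _ _).trans (Subset.trans ?_ hsub)
        exact (subset_tsupport _).trans (tsupport_deriv_subset (𝕜 := ℝ))
      · exact (Function.support_mul_subset_left _ _).trans ((subset_tsupport _).trans hsub))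
  refine ⟨fun x => C + ∫ t in (0 : ℝ)..x, f' t, fun a b => ?_, ?_, ?_⟩
  · exact (contDiff_const.contDiffOn.absolutelyContinuousOnInterval).add (hac a b)
  · filter_upwards [hC] with x hx; linarith
  · filter_upwards [hderiv] with x hx using hx.const_add C

/-! ### Bounded C¹ coefficients and vanishing boundary terms -/

/-- `a` has the continuous derivative `a'` on `ℝ`, and both functions are bounded. -/
structure BddC1 (a a' : ℝ → ℝ) : Prop where
  hasDerivAt : ∀ x, HasDerivAt a (a' x) x
  continuous_deriv : Continuous a'
  bdd : ∃ C, ∀ x, |a x| ≤ C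
  bdd_deriv : ∃ C, ∀ x, |a' x| ≤ C

theorem BddC1.continuous {a a' : ℝ → ℝ} (h : BddC1 a a') : Continuous a :=
  continuous_iff_continuousAt.2 fun x => (h.hasDerivAt x).continuousAt

/-- Products of a bounded continuous function and two `L²` functions are integrable. -/
theorem integrable_bdd_mul_memLp {a f g : ℝ → ℝ} (ha : Continuous a) (hb : ∃ C, ∀ x, |a x| ≤ C)
    (hf : MemLp f 2 volume) (hg : MemLp g 2 volume) :
    Integrable fun x => a x * (f x * g x) := by
  obtain ⟨C, hC⟩ := hb
  exact (hf.integrable_mul hg).bdd_mul ha.aestronglyMeasurable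
    (c := C) (ae_of_all _ hC)

/-- The integral over `ℝ` of the derivative of `a f g` vanishes, for `f, g` in `H¹(ℝ)`. -/
theorem integral_deriv_mul_mul_eq_zero {a a' f f' g g' : ℝ → ℝ} (ha : BddC1 a a')
    (hf : IsH1 f f') (hg : IsH1 g g') :
    Integrable (fun x => a' x * (f x * g x) + a x * (f' x * g x) + a x * (f x * g' x)) ∧
    ∫ x, (a' x * (f x * g x) + a x * (f' x * g x) + a x * (f x * g' x)) = 0 := by
  have hInt : Integrable
      (fun x => a' x * (f x * g x) + a x * (f' x * g x) + a x * (f x * g' x)) :=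
    ((integrable_bdd_mul_memLp ha.continuous_deriv ha.bdd_deriv hf.memLp hg.memLp).add
      (integrable_bdd_mul_memLp ha.continuous ha.bdd hf.memLp_deriv hg.memLp)).add
      (integrable_bdd_mul_memLp ha.continuous ha.bdd hf.memLp hg.memLp_deriv)
  refine ⟨hInt, ?_⟩
  obtain ⟨F, hF, hFf, hF'⟩ := hf.exists_absolutelyContinuous
  obtain ⟨G, hG, hGg, hG'⟩ := hg.exists_absolutelyContinuous
  have haC1 : ContDiff ℝ 1 a := by
    have hd : deriv a = a' := funext fun x => (ha.hasDerivAt x).deriv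
    exact contDiff_one_iff_deriv.2 ⟨fun x => (ha.hasDerivAt x).differentiableAt,
      hd ▸ ha.continuous_deriv⟩
  have hP : ∀ r s, AbsolutelyContinuousOnInterval (fun x => a x * (F x * G x)) r s := fun r s =>
    haC1.contDiffOn.absolutelyContinuousOnInterval.fun_mul ((hF r s).fun_mul (hG r s))
  have hPd : ∀ᵐ x, deriv (fun x => a x * (F x * G x)) x =
      a' x * (f x * g x) + a x * (f' x * g x) + a x * (f x * g' x) := by
    filter_upwards [hFf, hGg, hF', hG'] with x h1 h2 h3 h4
    have := ((ha.hasDerivAt x).mul (h3.mul h4)).deriv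
    refine Eq.trans this ?_
    rw [← h1, ← h2]; simp only [Pi.mul_apply]; ring
  have hPi : Integrable (fun x => a x * (F x * G x)) := by
    refine (integrable_bdd_mul_memLp ha.continuous ha.bdd hf.memLp hg.memLp).congr ?_
    filter_upwards [hFf, hGg] with x h1 h2
    rw [h1, h2]
  have ht : Tendsto (fun R : ℝ => a R * (F R * G R) - a (-R) * (F (-R) * G (-R))) atTop
      (𝓝 (∫ x, (a' x * (f x * g x) + a x * (f' x * g x) + a x * (f x * g' x)))) := by
    refine (intervalIntegral_tendsto_integral hInt tendsto_neg_atTop_atBot tendsto_id).congr ?_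
    intro R
    rw [← (hP (-R) R).integral_deriv_eq_sub]
    refine intervalIntegral.integral_congr_ae ?_
    filter_upwards [hPd] with x hx _ using hx.symm
  -- The boundary term is an integrable function of R with a limit as R → ∞; that limit can only be
  -- 0.
  refine IntegrableAtFilter.eq_zero_of_tendsto (μ := volume)
    ⟨univ, univ_mem, (hPi.sub hPi.comp_neg).integrableOn⟩ ?_ ht
  intro s hs
  rcases mem_atTop_sets.1 hs with ⟨b, hb⟩
  rw [← top_le_iff, ← Real.volume_Ici (a := b)]
  exact measure_mono hb

theorem BddC1.const (c : ℝ) : BddC1 (fun _ => c) (fun _ => 0) :=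
  ⟨fun x => hasDerivAt_const x c, continuous_const, ⟨|c|, fun _ => le_rfl⟩,
    ⟨0, fun _ => by simp⟩⟩

theorem BddC1.add {a a' b b' : ℝ → ℝ} (ha : BddC1 a a') (hb : BddC1 b b') :
    BddC1 (fun x => a x + b x) (fun x => a' x + b' x) := by
  obtain ⟨C, hC⟩ := ha.bdd
  obtain ⟨C', hC'⟩ := ha.bdd_deriv
  obtain ⟨K, hK⟩ := hb.bdd
  obtain ⟨K', hK'⟩ := hb.bdd_deriv
  exact ⟨fun x => (ha.hasDerivAt x).add (hb.hasDerivAt x),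
    ha.continuous_deriv.add hb.continuous_deriv,
    ⟨C + K, fun x => (abs_add_le _ _).trans (add_le_add (hC x) (hK x))⟩,
    ⟨C' + K', fun x => (abs_add_le _ _).trans (add_le_add (hC' x) (hK' x))⟩⟩

theorem BddC1.mul {a a' b b' : ℝ → ℝ} (ha : BddC1 a a') (hb : BddC1 b b') :
    BddC1 (fun x => a x * b x) (fun x => a' x * b x + a x * b' x) := by
  have key : ∀ {f g : ℝ → ℝ}, (∃ C, ∀ x, |f x| ≤ C) → (∃ C, ∀ x, |g x| ≤ C) →
      ∃ C, ∀ x, |f x * g x| ≤ C := by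
    rintro f g ⟨C, hC⟩ ⟨K, hK⟩
    refine ⟨C * K, fun x => ?_⟩
    rw [abs_mul]
    exact mul_le_mul (hC x) (hK x) (abs_nonneg _) ((abs_nonneg _).trans (hC x))
  obtain ⟨C, hC⟩ := key ha.bdd_deriv hb.bdd
  obtain ⟨K, hK⟩ := key ha.bdd hb.bdd_deriv
  exact ⟨fun x => (ha.hasDerivAt x).mul (hb.hasDerivAt x),
    (ha.continuous_deriv.mul hb.continuous).add (ha.continuous.mul hb.continuous_deriv),
    key ha.bdd hb.bdd,
    ⟨C + K, fun x => (abs_add_le _ _).trans (add_le_add (hC x) (hK x))⟩⟩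

theorem BddC1.inv {a a' : ℝ → ℝ} (ha : BddC1 a a') {m : ℝ} (hm : 0 < m) (h : ∀ x, m ≤ a x) :
    BddC1 (fun x => (a x)⁻¹) (fun x => -a' x / a x ^ 2) := by
  obtain ⟨C, hC⟩ := ha.bdd_deriv
  have hp : ∀ x, 0 < a x := fun x => hm.trans_le (h x)
  refine ⟨fun x => (ha.hasDerivAt x).inv (hp x).ne',
    ha.continuous_deriv.neg.div (ha.continuous.pow 2) fun x => (pow_pos (hp x) 2).ne',
    ⟨m⁻¹, fun x => ?_⟩, ⟨C / m ^ 2, fun x => ?_⟩⟩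
  · rw [abs_of_pos (inv_pos.2 (hp x))]
    exact inv_anti₀ hm (h x)
  · rw [abs_div, abs_neg, abs_of_pos (pow_pos (hp x) 2)]
    exact div_le_div₀ ((abs_nonneg _).trans (hC x)) (hC x) (pow_pos hm 2)
      (pow_le_pow_left₀ hm.le (h x) 2)

/-! ### The Jacobi amplitude and the profile equation -/

theorem one_sub_mul_sin_sq_pos {k : ℝ} (hk : k ^ 2 < 1) (θ : ℝ) :
    0 < 1 - k ^ 2 * Real.sin θ ^ 2 := by
  nlinarith [Real.sin_sq_le_one θ, sq_nonneg k]

theorem hasDerivAt_ellipticF {k : ℝ} (hk : k ^ 2 < 1) (φ : ℝ) :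
    HasDerivAt (ellipticF k) (1 / Real.sqrt (1 - k ^ 2 * Real.sin φ ^ 2)) φ := by
  have hc : Continuous fun θ => 1 / Real.sqrt (1 - k ^ 2 * Real.sin θ ^ 2) :=
    continuous_const.div (by fun_prop) fun θ =>
      (Real.sqrt_pos.2 (one_sub_mul_sin_sq_pos hk θ)).ne'
  exact (hc.integral_hasStrictDerivAt 0 φ).hasDerivAt

theorem ellipticF_strictMono {k : ℝ} (hk : k ^ 2 < 1) : StrictMono (ellipticF k) :=
  strictMono_of_deriv_pos fun φ => by
    rw [(hasDerivAt_ellipticF hk φ).deriv]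
    exact one_div_pos.2 (Real.sqrt_pos.2 (one_sub_mul_sin_sq_pos hk φ))

theorem ellipticF_surjective {k : ℝ} (hk : k ^ 2 < 1) : Function.Surjective (ellipticF k) := by
  -- The integrand is at least 1, so F(φ) - φ is monotone and F is unbounded in both directions.
  have hd : ∀ φ, HasDerivAt (fun φ => ellipticF k φ - φ)
      (1 / Real.sqrt (1 - k ^ 2 * Real.sin φ ^ 2) - 1) φ := fun φ =>
    (hasDerivAt_ellipticF hk φ).sub (hasDerivAt_id φ)
  have hm : Monotone fun φ => ellipticF k φ - φ := by
    refine monotone_of_deriv_nonneg (fun φ => (hd φ).differentiableAt) fun φ => ?_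
    rw [(hd φ).deriv, sub_nonneg, le_div_iff₀ (Real.sqrt_pos.2 (one_sub_mul_sin_sq_pos hk φ)),
      one_mul]
    refine Real.sqrt_le_one.2 ?_
    nlinarith [sq_nonneg k, sq_nonneg (Real.sin φ), mul_nonneg (sq_nonneg k)
      (sq_nonneg (Real.sin φ))]
  have h0 : ellipticF k 0 = 0 := by simp [ellipticF]
  have hcont : Continuous (ellipticF k) :=
    continuous_iff_continuousAt.2 fun φ => (hasDerivAt_ellipticF hk φ).continuousAt
  refine hcont.surjective ?_ ?_
  · refine tendsto_atTop_mono' _ ?_ tendsto_id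
    filter_upwards [eventually_ge_atTop 0] with φ hφ
    have := hm hφ
    simp only [h0] at this
    simp only [id]; linarith
  · refine tendsto_atBot_mono' _ ?_ tendsto_id
    filter_upwards [eventually_le_atBot 0] with φ hφ
    have := hm hφ
    simp only [h0] at this
    simp only [id]; linarith

theorem ellipticF_jacobiAm {k : ℝ} (hk : k ^ 2 < 1) (ξ : ℝ) :
    ellipticF k (jacobiAm ξ k) = ξ :=
  Function.rightInverse_invFun (ellipticF_surjective hk) ξ

theorem jacobiAm_ellipticF {k : ℝ} (hk : k ^ 2 < 1) (φ : ℝ) :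
    jacobiAm (ellipticF k φ) k = φ :=
  Function.leftInverse_invFun (ellipticF_strictMono hk).injective φ

theorem continuous_jacobiAm {k : ℝ} (hk : k ^ 2 < 1) : Continuous fun ξ => jacobiAm ξ k := by
  refine Monotone.continuous_of_surjective ?_ fun φ => ⟨_, jacobiAm_ellipticF hk φ⟩
  intro ξ ζ h
  rw [← (ellipticF_strictMono hk).le_iff_le, ellipticF_jacobiAm hk, ellipticF_jacobiAm hk]
  exact h

theorem hasDerivAt_jacobiAm {k : ℝ} (hk : k ^ 2 < 1) (ξ : ℝ) :
    HasDerivAt (fun ξ => jacobiAm ξ k)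
      (Real.sqrt (1 - k ^ 2 * Real.sin (jacobiAm ξ k) ^ 2)) ξ := by
  have hpos := Real.sqrt_pos.2 (one_sub_mul_sin_sq_pos hk (jacobiAm ξ k))
  have := HasDerivAt.of_local_left_inverse (continuous_jacobiAm hk).continuousAt
    (hasDerivAt_ellipticF hk (jacobiAm ξ k)) (one_div_pos.2 hpos).ne'
    (Eventually.of_forall fun y => ellipticF_jacobiAm hk y)
  simpa using this

/-- The profile `u₀` solves `u₀'' + (1 - u₀²) u₀ = 0` with first integral
`u₀'² = ((1 - u₀²)² - 𝓔²) / 2`. -/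
theorem profile_ode {𝓔 : ℝ} (h0 : 0 < 𝓔) (h1 : 𝓔 < 1) :
    ∃ W : ℝ → ℝ, (∀ x, HasDerivAt (profile 𝓔) (W x) x) ∧
      (∀ x, HasDerivAt W (-(1 - profile 𝓔 x ^ 2) * profile 𝓔 x) x) ∧
      (∀ x, W x ^ 2 = ((1 - profile 𝓔 x ^ 2) ^ 2 - 𝓔 ^ 2) / 2) ∧
      ∀ x, profile 𝓔 x ^ 2 ≤ 1 - 𝓔 := by
  set k := Real.sqrt ((1 - 𝓔) / (1 + 𝓔)) with hkdef
  set ν := Real.sqrt ((1 + 𝓔) / 2) with hνdef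
  set τ := Real.sqrt (1 - 𝓔) with hτdef
  have hk2 : k ^ 2 = (1 - 𝓔) / (1 + 𝓔) :=
    Real.sq_sqrt (div_nonneg (by linarith) (by linarith))
  have hν2 : ν ^ 2 = (1 + 𝓔) / 2 := Real.sq_sqrt (by linarith)
  have hτ2 : τ ^ 2 = 1 - 𝓔 := Real.sq_sqrt (by linarith)
  -- Together with ν² (1 + k²) = 1 this turns sn'' = -(1 + k²) sn + 2 k² sn³ into the equation of
  -- the profile.
  have hνk : ν ^ 2 * k ^ 2 = τ ^ 2 / 2 := by
    rw [hk2, hν2, hτ2]; field_simp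
  have hk : k ^ 2 < 1 := by
    rw [hk2, div_lt_one (by linarith)]; linarith
  set am : ℝ → ℝ := fun x => jacobiAm (x * ν) k with ham
  set dn : ℝ → ℝ := fun x => Real.sqrt (1 - k ^ 2 * Real.sin (am x) ^ 2) with hdn
  have hdnpos : ∀ x, 0 < dn x := fun x => Real.sqrt_pos.2 (one_sub_mul_sin_sq_pos hk _)
  have hdn2 : ∀ x, dn x ^ 2 = 1 - k ^ 2 * Real.sin (am x) ^ 2 := fun x =>
    Real.sq_sqrt (one_sub_mul_sin_sq_pos hk _).le
  have hu : ∀ x, profile 𝓔 x = τ * Real.sin (am x) := fun x => rfl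
  have hamd : ∀ x, HasDerivAt am (dn x * ν) x := fun x => by
    have h2 : HasDerivAt (fun x : ℝ => x * ν) ν x := by
      simpa using (hasDerivAt_id x).mul_const ν
    exact HasDerivAt.comp x (h₂ := fun ξ => jacobiAm ξ k) (hasDerivAt_jacobiAm hk (x * ν)) h2
  have hdnd : ∀ x, HasDerivAt dn (-(k ^ 2 * Real.sin (am x) * Real.cos (am x) * ν)) x := by
    intro x
    have h3 : HasDerivAt (fun x => 1 - k ^ 2 * Real.sin (am x) ^ 2)
        (-(k ^ 2 * (2 * Real.sin (am x) * (Real.cos (am x) * (dn x * ν))))) x := by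
      have := (((hamd x).sin.pow 2).const_mul (k ^ 2)).const_sub 1
      exact this.congr_deriv (by push_cast; ring)
    have h4 := h3.sqrt (one_sub_mul_sin_sq_pos hk _).ne'
    convert h4 using 1
    have := (hdnpos x).ne'
    change _ = _ / (2 * dn x)
    field_simp
  refine ⟨fun x => τ * (Real.cos (am x) * (dn x * ν)), fun x => ?_, fun x => ?_, fun x => ?_,
    fun x => ?_⟩
  · exact (hamd x).sin.const_mul τ
  · have := ((hamd x).cos.mul ((hdnd x).mul_const ν)).const_mul τ
    refine this.congr_deriv ?_
    rw [hu]
    have hc := Real.cos_sq' (am x)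
    linear_combination (-τ * ν ^ 2 * Real.sin (am x)) * hdn2 x
      - τ * k ^ 2 * ν ^ 2 * Real.sin (am x) * hc
      - τ * Real.sin (am x) * (1 - 2 * Real.sin (am x) ^ 2) * hνk
      - τ * Real.sin (am x) * hν2 - τ * Real.sin (am x) / 2 * hτ2
  · rw [hu]
    have hc := Real.cos_sq' (am x)
    have hE : 𝓔 = 1 - τ ^ 2 := by linarith
    have hν2' : ν ^ 2 = 1 - τ ^ 2 / 2 := by rw [hν2, hE]; ring
    have : (τ * (Real.cos (am x) * (dn x * ν))) ^ 2
        = τ ^ 2 * Real.cos (am x) ^ 2 * (ν ^ 2 * dn x ^ 2) := by ring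
    rw [this, hdn2, hc, hE]
    linear_combination τ ^ 2 * (1 - Real.sin (am x) ^ 2) * hν2'
      - τ ^ 2 * (1 - Real.sin (am x) ^ 2) * Real.sin (am x) ^ 2 * hνk
  · rw [hu, mul_pow, hτ2]
    nlinarith [Real.sin_sq_le_one (am x)]

/-! ### Discriminant inequalities along the orbit -/

theorem sq_add_two_mul_add_nonneg {q m : ℝ} (h : q ^ 2 ≤ m) (f g : ℝ) :
    0 ≤ f ^ 2 + 2 * q * (f * g) + m * g ^ 2 := by
  nlinarith [sq_nonneg (f + q * g), mul_nonneg (sub_nonneg.2 h) (sq_nonneg g)]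

/-- Rescaled form of the discriminant condition for perturbations `i v` of the profile. -/
theorem imag_discriminant_rescaled {r d Y Z e : ℝ} (hr : 0 < r) (hr' : r ≤ 1 / 100)
    (hd : d ^ 2 ≤ 2 * (1 - 10 * r)) (hY : 0 ≤ Y) (hY' : Y ≤ 1)
    (hZ : (1 - Y) * (1 - r ^ 2) ≤ Z) (hZ' : Z ≤ 1 - Y) (he : 1 ≤ e) (he' : e ≤ 1 + 2 * r ^ 2) :
    Z * (d * e - r * d ^ 2 * Y / 2) ^ 2
      ≤ 1 - 2 * r * d * (Y * Z) * e ^ 2 + d ^ 2 / 2 * (Z - Y + r ^ 2 * Y ^ 2) := by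
  have hrr : r ^ 2 ≤ r / 100 := by nlinarith
  have hd2 : d ^ 2 ≤ 2 := by linarith
  have hd0 := sq_nonneg d
  have hda : |d| ≤ 3 / 2 := abs_le_of_sq_le_sq (by norm_num; linarith) (by norm_num)
  have hZ0 : 0 ≤ Z := le_trans (mul_nonneg (by linarith) (by nlinarith)) hZ
  have hYZ0 : 0 ≤ Y * Z := mul_nonneg hY hZ0
  have hYZ : Y * Z ≤ 1 / 4 := by nlinarith [sq_nonneg (Y - 1 / 2)]
  have he1 : e ≤ 101 / 100 := by linarith
  have he2 : e ^ 2 ≤ 1 + 5 * r ^ 2 := by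
    have : e ^ 2 ≤ (1 + 2 * r ^ 2) ^ 2 := by gcongr
    nlinarith [sq_nonneg r]
  have he2' : e ^ 2 ≤ 11 / 10 := by nlinarith
  -- The leading parts in `t1` and `t5` reduce the claim to d² (1 - Y) ≤ 1 + d² (1 - 2 Y)/2, that is
  -- d² ≤ 2. The errors in `t1` to `t5` add up to less than the available 10 r.
  have t1 : Z * d ^ 2 * e ^ 2 ≤ d ^ 2 * (1 - Y) + r / 5 := by
    have : Z * d ^ 2 * e ^ 2 ≤ (1 - Y) * d ^ 2 * (1 + 5 * r ^ 2) := by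
      gcongr
    linarith [mul_le_mul_of_nonneg_right
      (mul_le_mul (by linarith : 1 - Y ≤ 1) hd2 hd0 zero_le_one) (sq_nonneg r)]
  have t2 : |r * d ^ 2 * d * e * (Y * Z)| ≤ r := by
    rw [abs_mul, abs_mul, abs_mul, abs_mul, abs_of_pos hr, abs_of_nonneg hd0,
      abs_of_nonneg (by linarith : (0 : ℝ) ≤ e), abs_of_nonneg hYZ0]
    calc r * d ^ 2 * |d| * e * (Y * Z) ≤ r * 2 * (3 / 2) * (101 / 100) * (1 / 4) := by gcongr
      _ ≤ r := by linarith
  have t3 : Z * (r * d ^ 2 * Y / 2) ^ 2 ≤ r := by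
    have : Z * (r * d ^ 2 * Y / 2) ^ 2 = r ^ 2 * d ^ 2 * d ^ 2 * Y * (Y * Z) / 4 := by ring
    rw [this]
    calc r ^ 2 * d ^ 2 * d ^ 2 * Y * (Y * Z) / 4 ≤ r ^ 2 * 2 * 2 * 1 * (1 / 4) / 4 := by gcongr
      _ ≤ r := by nlinarith
  have t4 : |2 * r * d * (Y * Z) * e ^ 2| ≤ r := by
    rw [abs_mul, abs_mul, abs_mul, abs_of_pos (by linarith : 0 < 2 * r), abs_of_nonneg hYZ0,
      abs_of_nonneg (sq_nonneg e)]
    calc 2 * r * |d| * (Y * Z) * e ^ 2 ≤ 2 * r * (3 / 2) * (1 / 4) * (11 / 10) := by gcongr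
      _ ≤ r := by linarith
  have t5 : d ^ 2 / 2 * (1 - 2 * Y) - r ≤ d ^ 2 / 2 * (Z - Y + r ^ 2 * Y ^ 2) := by
    have : 1 - 2 * Y - r ^ 2 ≤ Z - Y + r ^ 2 * Y ^ 2 := by
      nlinarith [mul_nonneg (sq_nonneg r) (sq_nonneg Y), mul_nonneg (sq_nonneg r) hY]
    have := mul_le_mul_of_nonneg_left this (by linarith : 0 ≤ d ^ 2 / 2)
    linarith [mul_le_mul_of_nonneg_right hd2 (sq_nonneg r)]
  have hx : Z * (d * e - r * d ^ 2 * Y / 2) ^ 2 = Z * d ^ 2 * e ^ 2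
      - r * d ^ 2 * d * e * (Y * Z) + Z * (r * d ^ 2 * Y / 2) ^ 2 := by ring
  rw [hx]
  linarith [(abs_le.1 t2).1, (abs_le.1 t4).2]

/-- Rescaled form of the discriminant condition for real perturbations of the profile. -/
theorem real_discriminant_rescaled {r d Y Z e b i : ℝ} (hr : 0 < r) (hr' : r ≤ 1 / 100)
    (hd : d ^ 2 ≤ 2 * (1 - 10 * r)) (hY : 0 ≤ Y) (hY' : Y ≤ 1)
    (hZ : 0 ≤ Z) (hZ' : Z ≤ 1 - Y) (he : 1 ≤ e) (he' : e ≤ 1 + 2 * r ^ 2)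
    (hb : 1 - r ^ 2 ≤ b) (hb' : b ≤ 1) (hi : i * b = 1) :
    Y * (d * b * e - r * d ^ 2 * Z * i / 2) ^ 2
      ≤ 1 + 2 * r * d * (-(Y * b * e) + Y ^ 2 * b ^ 2 * e ^ 2)
        - d ^ 2 / 2 * (Z - Y + r ^ 2 * Y ^ 2) - r ^ 2 * d ^ 2 * (Y * Z) * i := by
  have hrr : r ^ 2 ≤ r / 100 := by nlinarith
  have hd2 : d ^ 2 ≤ 2 := by linarith
  have hd0 := sq_nonneg d
  have hda : |d| ≤ 3 / 2 := abs_le_of_sq_le_sq (by norm_num; linarith) (by norm_num)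
  have hYZ0 : 0 ≤ Y * Z := mul_nonneg hY hZ
  have hYZ : Y * Z ≤ 1 / 4 := by nlinarith [sq_nonneg (Y - 1 / 2)]
  have he1 : e ≤ 101 / 100 := by linarith
  have he2 : e ^ 2 ≤ 1 + 5 * r ^ 2 := by
    have : e ^ 2 ≤ (1 + 2 * r ^ 2) ^ 2 := by gcongr
    nlinarith [sq_nonneg r]
  have hb0 : 1 / 2 ≤ b := by linarith
  have hb2 : b ^ 2 ≤ 1 := pow_le_one₀ (by linarith) hb'
  have hi' : i = b⁻¹ := eq_inv_of_mul_eq_one_left hi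
  have hi0 : 0 ≤ i := by rw [hi']; positivity
  have hi2 : i ≤ 2 := by
    rw [hi', inv_le_comm₀ (by linarith) two_pos]; linarith
  -- The leading parts are now d² Y ≤ 1 - d² (1 - 2 Y)/2, again d² ≤ 2. The errors add up to 8.2 r,
  -- which the 10 r in the hypothesis on d covers.
  have t1 : Y * d ^ 2 * b ^ 2 * e ^ 2 ≤ d ^ 2 * Y + r / 5 := by
    have : Y * d ^ 2 * b ^ 2 * e ^ 2 ≤ Y * d ^ 2 * 1 * (1 + 5 * r ^ 2) := by gcongr
    linarith [mul_le_mul_of_nonneg_right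
      (mul_le_mul hY' hd2 hd0 zero_le_one) (sq_nonneg r)]
  have t2 : |r * d ^ 2 * d * e * (Y * Z)| ≤ r := by
    rw [abs_mul, abs_mul, abs_mul, abs_mul, abs_of_pos hr, abs_of_nonneg hd0,
      abs_of_nonneg (by linarith : (0 : ℝ) ≤ e), abs_of_nonneg hYZ0]
    calc r * d ^ 2 * |d| * e * (Y * Z) ≤ r * 2 * (3 / 2) * (101 / 100) * (1 / 4) := by gcongr
      _ ≤ r := by linarith
  have t3 : Y * (r * d ^ 2 * Z * i / 2) ^ 2 ≤ r := by
    have : Y * (r * d ^ 2 * Z * i / 2) ^ 2 = r ^ 2 * d ^ 2 * d ^ 2 * Z * (Y * Z) * i ^ 2 / 4 := by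
      ring
    rw [this]
    calc r ^ 2 * d ^ 2 * d ^ 2 * Z * (Y * Z) * i ^ 2 / 4
        ≤ r ^ 2 * 2 * 2 * 1 * (1 / 4) * 2 ^ 2 / 4 := by
          gcongr
          linarith
      _ ≤ r := by nlinarith
  have t4 : |2 * r * d * (-(Y * b * e) + Y ^ 2 * b ^ 2 * e ^ 2)| ≤ 4 * r := by
    have h0 : 0 ≤ Y * b * e := by positivity
    have h1 : Y * b * e ≤ 1 * 1 * (101 / 100) := by gcongr
    have h2 : |-(Y * b * e) + Y ^ 2 * b ^ 2 * e ^ 2| ≤ 1 := by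
      rw [← mul_pow, ← mul_pow]
      generalize Y * b * e = s at h0 h1
      rw [abs_le]; constructor <;> nlinarith
    rw [abs_mul, abs_mul, abs_of_pos (by linarith : 0 < 2 * r)]
    calc 2 * r * |d| * |-(Y * b * e) + Y ^ 2 * b ^ 2 * e ^ 2| ≤ 2 * r * (3 / 2) * 1 := by gcongr
      _ ≤ 4 * r := by linarith
  have t5 : d ^ 2 / 2 * (Z - Y + r ^ 2 * Y ^ 2) ≤ d ^ 2 / 2 * (1 - 2 * Y) + r := by
    have hY2 : Y ^ 2 ≤ 1 := pow_le_one₀ (by assumption) (by assumption)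
    have : Z - Y + r ^ 2 * Y ^ 2 ≤ 1 - 2 * Y + r ^ 2 := by
      linarith [mul_le_mul_of_nonneg_left hY2 (sq_nonneg r)]
    have := mul_le_mul_of_nonneg_left this (by linarith : 0 ≤ d ^ 2 / 2)
    linarith [mul_le_mul_of_nonneg_right hd2 (sq_nonneg r)]
  have t6 : r ^ 2 * d ^ 2 * (Y * Z) * i ≤ r := by
    calc r ^ 2 * d ^ 2 * (Y * Z) * i ≤ r ^ 2 * 2 * (1 / 4) * 2 := by gcongr
      _ ≤ r := by linarith
  have hx : Y * (d * b * e - r * d ^ 2 * Z * i / 2) ^ 2 = Y * d ^ 2 * b ^ 2 * e ^ 2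
      - r * d ^ 2 * d * e * (Y * Z) + Y * (r * d ^ 2 * Z * i / 2) ^ 2 := by
    have h : i * b * (r * d ^ 2 * d * e * (Y * Z)) = r * d ^ 2 * d * e * (Y * Z) := by
      rw [hi, one_mul]
    rw [← h]; ring
  rw [hx]
  linarith [(abs_le.1 t2).1, (abs_le.1 t4).1]

/-- Bounds on the rescaled quantities attached to a point `(U, W)` of the orbit of the profile. -/
theorem orbit_rescaled {r U W : ℝ} (hr : 0 < r) (hr' : r ≤ 1 / 100)
    (hU : U ^ 2 ≤ r ^ 2) (hW : W ^ 2 = ((1 - U ^ 2) ^ 2 - (1 - r ^ 2) ^ 2) / 2) :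
    ∃ Y Z Δ : ℝ, U ^ 2 = r ^ 2 * Y ∧ W ^ 2 = r ^ 2 * Z ∧ W ^ 2 + U ^ 2 - U ^ 4 = r ^ 2 * Δ ∧
      0 ≤ Y ∧ Y ≤ 1 ∧ (1 - Y) * (1 - r ^ 2) ≤ Z ∧ Z ≤ 1 - Y ∧ 0 < Δ ∧
      1 ≤ Δ⁻¹ ∧ Δ⁻¹ ≤ 1 + 2 * r ^ 2 := by
  have hr2 : 0 < r ^ 2 := by positivity
  have hrs : r ^ 2 ≤ 1 / 100 := by nlinarith
  have hUY : U ^ 2 = r ^ 2 * (U ^ 2 / r ^ 2) := by field_simp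
  have hY0 : 0 ≤ U ^ 2 / r ^ 2 := by positivity
  have hY1 : U ^ 2 / r ^ 2 ≤ 1 := (div_le_one hr2).2 hU
  set Y := U ^ 2 / r ^ 2 with hY
  have hY2 : Y ^ 2 ≤ 1 := pow_le_one₀ (by assumption) (by assumption)
  have hWZ : W ^ 2 = r ^ 2 * ((1 - Y) * (1 - r ^ 2 * (1 + Y) / 2)) := by
    rw [hW, hUY]; ring
  have hΔ : 1 - r ^ 2 ≤ 1 - r ^ 2 * (1 + Y ^ 2) / 2 := by nlinarith
  have hΔ0 : 0 < 1 - r ^ 2 * (1 + Y ^ 2) / 2 := by linarith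
  have hΔ1 : 1 - r ^ 2 * (1 + Y ^ 2) / 2 ≤ 1 := by nlinarith [sq_nonneg Y]
  refine ⟨Y, (1 - Y) * (1 - r ^ 2 * (1 + Y) / 2), 1 - r ^ 2 * (1 + Y ^ 2) / 2, hUY, hWZ, ?_,
    hY0, hY1, ?_, ?_, hΔ0, ?_, ?_⟩
  · rw [hWZ, show U ^ 4 = (U ^ 2) ^ 2 by ring, hUY]; ring
  · refine mul_le_mul_of_nonneg_left ?_ (by linarith); nlinarith
  · nlinarith [mul_nonneg hr2.le hY0]
  · exact (one_le_inv₀ hΔ0).2 hΔ1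
  · rw [inv_le_iff_one_le_mul₀ hΔ0]
    nlinarith [mul_le_mul_of_nonneg_left hΔ (by positivity : 0 ≤ 1 + 2 * r ^ 2)]

/-- This is q² ≤ m for the form in f and g. Substituting U² = r² Y, U'² = r² Z and D = r² Δ cancels
the negative powers of r, including the one in d²/(2 r²). -/
theorem imag_discriminant {r d U W : ℝ} (hr : 0 < r) (hr' : r ≤ 1 / 100)
    (hd : d ^ 2 ≤ 2 * (1 - 10 * r))
    (hU : U ^ 2 ≤ r ^ 2) (hW : W ^ 2 = ((1 - U ^ 2) ^ 2 - (1 - r ^ 2) ^ 2) / 2) :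
    (r * d * W / (W ^ 2 + U ^ 2 - U ^ 4) - d ^ 2 / (2 * r ^ 2) * U ^ 2 * W) ^ 2
      ≤ 1 - 2 * (r * d) * U ^ 2 * W ^ 2 / (W ^ 2 + U ^ 2 - U ^ 4) ^ 2
        + d ^ 2 / (2 * r ^ 2) * (W ^ 2 - (1 - U ^ 2) * U ^ 2) := by
  obtain ⟨Y, Z, Δ, h1, h2, h3, hY, hY', hZ, hZ', hΔ, he, he'⟩ := orbit_rescaled hr hr' hU hW
  have key := imag_discriminant_rescaled hr hr' hd hY hY' hZ hZ' he he'
  have e1 : (r * d * W / (r ^ 2 * Δ) - d ^ 2 / (2 * r ^ 2) * (r ^ 2 * Y) * W) ^ 2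
      = Z * (d * Δ⁻¹ - r * d ^ 2 * Y / 2) ^ 2 := by
    have : (r * d * W / (r ^ 2 * Δ) - d ^ 2 / (2 * r ^ 2) * (r ^ 2 * Y) * W) ^ 2
      = W ^ 2 * (r * d / (r ^ 2 * Δ) - d ^ 2 / (2 * r ^ 2) * (r ^ 2 * Y)) ^ 2 := by ring
    rw [this, h2]
    field_simp
  have e2 : 1 - 2 * (r * d) * (r ^ 2 * Y) * (r ^ 2 * Z) / (r ^ 2 * Δ) ^ 2
        + d ^ 2 / (2 * r ^ 2) * (r ^ 2 * Z - (1 - r ^ 2 * Y) * (r ^ 2 * Y))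
      = 1 - 2 * r * d * (Y * Z) * Δ⁻¹ ^ 2 + d ^ 2 / 2 * (Z - Y + r ^ 2 * Y ^ 2) := by
    field_simp
    ring
  rw [h3, h1, e1, h2, e2]
  exact key

/-- This is q² ≤ m for the form in F and G, by the same rescaling; the additional factor 1 - U²
stays close to 1. -/
theorem real_discriminant {r d U W : ℝ} (hr : 0 < r) (hr' : r ≤ 1 / 100)
    (hd : d ^ 2 ≤ 2 * (1 - 10 * r))
    (hU : U ^ 2 ≤ r ^ 2) (hW : W ^ 2 = ((1 - U ^ 2) ^ 2 - (1 - r ^ 2) ^ 2) / 2) :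
    (-(r * d * U * (1 - U ^ 2) / (W ^ 2 + U ^ 2 - U ^ 4))
        + d ^ 2 / (2 * r ^ 2) * U * W ^ 2 / (1 - U ^ 2)) ^ 2
      ≤ 1 + 2 * (r * d) * (-(U ^ 2 * (1 - U ^ 2) / (W ^ 2 + U ^ 2 - U ^ 4))
          + (U ^ 2 * (1 - U ^ 2) / (W ^ 2 + U ^ 2 - U ^ 4)) ^ 2)
        - d ^ 2 / (2 * r ^ 2) * (W ^ 2 - (1 - U ^ 2) * U ^ 2)
        - 2 * (d ^ 2 / (2 * r ^ 2)) * U ^ 2 * W ^ 2 / (1 - U ^ 2) := by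
  obtain ⟨Y, Z, Δ, h1, h2, h3, hY, hY', hZ, hZ', hΔ, he, he'⟩ := orbit_rescaled hr hr' hU hW
  have hrs : r ^ 2 ≤ 1 / 100 := by nlinarith
  have hb : 1 - r ^ 2 ≤ 1 - r ^ 2 * Y := by nlinarith [sq_nonneg r]
  have hb0 : 0 < 1 - r ^ 2 * Y := by linarith
  have hZ0 : 0 ≤ Z := le_trans (mul_nonneg (by linarith) (by linarith)) hZ
  have key := real_discriminant_rescaled hr hr' hd hY hY' hZ0 hZ' he he' hb
    (by nlinarith [sq_nonneg r]) (inv_mul_cancel₀ hb0.ne')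
  have hb1 := hb0.ne'
  generalize hbb : 1 - r ^ 2 * Y = b at *
  have e1 : (-(r * d * U * b / (r ^ 2 * Δ)) + d ^ 2 / (2 * r ^ 2) * U * (r ^ 2 * Z) / b) ^ 2
      = Y * (d * b * Δ⁻¹ - r * d ^ 2 * Z * b⁻¹ / 2) ^ 2 := by
    have : (-(r * d * U * b / (r ^ 2 * Δ)) + d ^ 2 / (2 * r ^ 2) * U * (r ^ 2 * Z) / b) ^ 2
      = U ^ 2 * (-(r * d * b / (r ^ 2 * Δ)) + d ^ 2 / (2 * r ^ 2) * (r ^ 2 * Z) / b) ^ 2 := by ring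
    rw [this, h1]
    field_simp
    ring
  have e2 : 1 + 2 * (r * d) * (-(r ^ 2 * Y * b / (r ^ 2 * Δ))
          + (r ^ 2 * Y * b / (r ^ 2 * Δ)) ^ 2)
        - d ^ 2 / (2 * r ^ 2) * (r ^ 2 * Z - b * (r ^ 2 * Y))
        - 2 * (d ^ 2 / (2 * r ^ 2)) * (r ^ 2 * Y) * (r ^ 2 * Z) / b
      = 1 + 2 * r * d * (-(Y * b * Δ⁻¹) + Y ^ 2 * b ^ 2 * Δ⁻¹ ^ 2)
        - d ^ 2 / 2 * (Z - Y + r ^ 2 * Y ^ 2) - r ^ 2 * d ^ 2 * (Y * Z) * b⁻¹ := by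
    rw [show Z - Y + r ^ 2 * Y ^ 2 = Z - Y * b by rw [← hbb]; ring]
    field_simp
  rw [h3, h1, h2, hbb, e1, e2]
  exact key

/-! ### Null Lagrangians and the two quadratic forms -/

/-- A density which exceeds the total derivative of `A v² + B v v' + C v'²` pointwise has a
nonnegative integral. -/
theorem integral_nonneg_of_null_lagrangian {N A A' B B' C C' v v₁ v₂ : ℝ → ℝ}
    (hA : BddC1 A A') (hB : BddC1 B B') (hC : BddC1 C C') (hv : IsH1 v v₁) (hv₁ : IsH1 v₁ v₂)
    (hN : Integrable N)
    (h : ∀ x, 0 ≤ N x - (A' x * v x ^ 2 + 2 * A x * (v x * v₁ x) + B' x * (v x * v₁ x)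
      + B x * (v₁ x ^ 2 + v x * v₂ x) + C' x * v₁ x ^ 2 + 2 * C x * (v₁ x * v₂ x))) :
    0 ≤ ∫ x, N x := by
  obtain ⟨iA, zA⟩ := integral_deriv_mul_mul_eq_zero hA hv hv
  obtain ⟨iB, zB⟩ := integral_deriv_mul_mul_eq_zero hB hv hv₁
  obtain ⟨iC, zC⟩ := integral_deriv_mul_mul_eq_zero hC hv₁ hv₁
  have hpos := integral_nonneg_of_ae (μ := volume) (ae_of_all _ h)
  have e : (fun x => N x - (A' x * v x ^ 2 + 2 * A x * (v x * v₁ x) + B' x * (v x * v₁ x)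
      + B x * (v₁ x ^ 2 + v x * v₂ x) + C' x * v₁ x ^ 2 + 2 * C x * (v₁ x * v₂ x))) =
      fun x => N x - ((A' x * (v x * v x) + A x * (v₁ x * v x) + A x * (v x * v₁ x))
        + (B' x * (v x * v₁ x) + B x * (v₁ x * v₁ x) + B x * (v x * v₂ x))
        + (C' x * (v₁ x * v₁ x) + C x * (v₂ x * v₁ x) + C x * (v₁ x * v₂ x))) := by
    funext x; ring
  rw [e, integral_sub hN ((iA.fun_add iB).fun_add iC), integral_add (iA.fun_add iB) iC,
    integral_add iA iB, zA, zB, zC] at hpos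
  linarith

/-- Quadratic density of the second variation on purely imaginary perturbations `i v`, at a point
where the profile takes the value `U` and its derivative the value `W`. -/
def imagDensity (𝓔 c U W v v₁ v₂ : ℝ) : ℝ :=
  v₂ ^ 2 + 3 * U ^ 2 * v₁ ^ 2 + 3 * W ^ 2 * v ^ 2 + 4 * U * W * (v * v₁) + 3 / 2 * U ^ 4 * v ^ 2
    - (3 - 𝓔 ^ 2) / 2 * v ^ 2 - c * (v₁ ^ 2 - (1 - U ^ 2) * v ^ 2)

/-- Quadratic density of the second variation on real perturbations `u`, at a point
where the profile takes the value `U` and its derivative the value `W`. -/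
def realDensity (𝓔 c U W u u₁ u₂ : ℝ) : ℝ :=
  u₂ ^ 2 + 5 * U ^ 2 * u₁ ^ 2 + 5 * W ^ 2 * u ^ 2 + 20 * U * W * (u * u₁) + 15 / 2 * U ^ 4 * u ^ 2
    - (3 - 𝓔 ^ 2) / 2 * u ^ 2 - c * (u₁ ^ 2 - (1 - 3 * U ^ 2) * u ^ 2)

section Profile

variable {r d : ℝ} {U W : ℝ → ℝ}

/-- A bounded solution `U` of `U'' + (1 - U²) U = 0`, with derivative `W`, on the energy level
`𝓔 = 1 - r²`. -/
structure IsProfile (r : ℝ) (U W : ℝ → ℝ) : Prop where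
  hasDerivAt : ∀ x, HasDerivAt U (W x) x
  hasDerivAt_deriv : ∀ x, HasDerivAt W (-(1 - U x ^ 2) * U x) x
  energy : ∀ x, W x ^ 2 = ((1 - U x ^ 2) ^ 2 - (1 - r ^ 2) ^ 2) / 2
  sq_le : ∀ x, U x ^ 2 ≤ r ^ 2

theorem IsProfile.bddC1 (h : IsProfile r U W) : BddC1 U W := by
  have hc : Continuous W :=
    continuous_iff_continuousAt.2 fun x => (h.hasDerivAt_deriv x).continuousAt
  refine ⟨h.hasDerivAt, hc, ⟨|r|, fun x => sq_le_sq.1 (h.sq_le x)⟩,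
    ⟨1 + r ^ 2, fun x => abs_le_of_sq_le_sq ?_ (by positivity)⟩⟩
  rw [h.energy]
  nlinarith [sq_nonneg (1 - r ^ 2), h.sq_le x, sq_nonneg (U x), sq_nonneg r,
    mul_nonneg (sq_nonneg (U x)) (sub_nonneg.2 (h.sq_le x))]

theorem IsProfile.bddC1_deriv (h : IsProfile r U W) :
    BddC1 W (fun x => -(1 - U x ^ 2) * U x) := by
  have hU := h.bddC1
  obtain ⟨C, hC⟩ := (((BddC1.const (-1)).mul hU).add (hU.mul (hU.mul hU))).bdd
  refine ⟨h.hasDerivAt_deriv, ?_, hU.bdd_deriv, ⟨C, fun x => ?_⟩⟩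
  · have := hU.continuous
    fun_prop
  · refine le_of_eq_of_le ?_ (hC x)
    congr 1; ring

/-- The quantity `U'² - U U''` stays away from zero, and its inverse is bounded and `C¹`. -/
theorem IsProfile.bddC1_inv_wronskian (h : IsProfile r U W) (hr : 0 < r) (hr' : r ≤ 1 / 100) :
    BddC1 (fun x => (W x * W x + U x * U x + (-1) * (U x * U x * (U x * U x)))⁻¹)
      (fun x => 2 * U x ^ 3 * W x / (W x * W x + U x * U x + (-1) * (U x * U x * (U x * U x))) ^ 2)
    := by
  have hU := h.bddC1
  have hW := h.bddC1_deriv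
  have := (((hW.mul hW).add (hU.mul hU)).add
    ((BddC1.const (-1)).mul ((hU.mul hU).mul (hU.mul hU)))).inv (m := r ^ 2 / 2) (by positivity)
    (fun x => by
      obtain ⟨Y, Z, Δ, -, -, h3, -, -, -, -, hΔ, -, h4⟩ :=
        orbit_rescaled hr hr' (h.sq_le x) (h.energy x)
      have h5 : 1 / 2 ≤ Δ := by
        have : Δ⁻¹ ≤ 2 := by nlinarith
        rw [inv_le_comm₀ hΔ two_pos] at this
        linarith
      nlinarith [sq_nonneg r])
  convert this using 2 with x
  ring

theorem IsProfile.bddC1_inv_one_sub_sq (h : IsProfile r U W) (hr : 0 < r) (hr' : r ≤ 1 / 100) :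
    BddC1 (fun x => (1 + (-1) * (U x * U x))⁻¹)
      (fun x => 2 * U x * W x / (1 + (-1) * (U x * U x)) ^ 2) := by
  have hU := h.bddC1
  have := ((BddC1.const 1).add ((BddC1.const (-1)).mul (hU.mul hU))).inv (m := 1 / 2) (by norm_num)
    (fun x => by nlinarith [h.sq_le x])
  convert this using 2 with x
  ring

theorem integrable_mul_mul_of_bddC1 {a a' f g : ℝ → ℝ} (ha : BddC1 a a')
    (hf : MemLp f 2 volume) (hg : MemLp g 2 volume) : Integrable fun x => a x * (f x * g x) :=
  integrable_bdd_mul_memLp ha.continuous ha.bdd hf hg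

theorem IsProfile.integrable_imagDensity (h : IsProfile r U W) (𝓔 c : ℝ) {v v₁ v₂ : ℝ → ℝ}
    (hv : IsH1 v v₁) (hv₁ : IsH1 v₁ v₂) :
    Integrable fun x => imagDensity 𝓔 c (U x) (W x) (v x) (v₁ x) (v₂ x) := by
  have hU := h.bddC1
  have hW := h.bddC1_deriv
  have k := BddC1.const
  have i1 := integrable_mul_mul_of_bddC1 (k 1) hv₁.memLp_deriv hv₁.memLp_deriv
  have i2 := integrable_mul_mul_of_bddC1
    (((k 3).mul (hU.mul hU)).add (k (-c))) hv₁.memLp hv₁.memLp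
  have i3 := integrable_mul_mul_of_bddC1 ((k 4).mul (hU.mul hW)) hv.memLp hv₁.memLp
  have i4 := integrable_mul_mul_of_bddC1 ((((k 3).mul (hW.mul hW)).add
    ((k (3 / 2)).mul ((hU.mul hU).mul (hU.mul hU)))).add ((k (c - (3 - 𝓔 ^ 2) / 2)).add
    ((k (-c)).mul (hU.mul hU)))) hv.memLp hv.memLp
  refine (((i1.add i2).add i3).add i4).congr (ae_of_all _ fun x => ?_)
  simp only [Pi.add_apply, imagDensity]
  ring

theorem IsProfile.integrable_realDensity (h : IsProfile r U W) (𝓔 c : ℝ) {v v₁ v₂ : ℝ → ℝ}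
    (hv : IsH1 v v₁) (hv₁ : IsH1 v₁ v₂) :
    Integrable fun x => realDensity 𝓔 c (U x) (W x) (v x) (v₁ x) (v₂ x) := by
  have hU := h.bddC1
  have hW := h.bddC1_deriv
  have k := BddC1.const
  have i1 := integrable_mul_mul_of_bddC1 (k 1) hv₁.memLp_deriv hv₁.memLp_deriv
  have i2 := integrable_mul_mul_of_bddC1
    (((k 5).mul (hU.mul hU)).add (k (-c))) hv₁.memLp hv₁.memLp
  have i3 := integrable_mul_mul_of_bddC1 ((k 20).mul (hU.mul hW)) hv.memLp hv₁.memLp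
  have i4 := integrable_mul_mul_of_bddC1 ((((k 5).mul (hW.mul hW)).add
    ((k (15 / 2)).mul ((hU.mul hU).mul (hU.mul hU)))).add ((k (c - (3 - 𝓔 ^ 2) / 2)).add
    ((k (-3 * c)).mul (hU.mul hU)))) hv.memLp hv.memLp
  refine (((i1.add i2).add i3).add i4).congr (ae_of_all _ fun x => ?_)
  simp only [Pi.add_apply, realDensity]
  ring

/-- Nonnegativity of the second variation on purely imaginary perturbations. Up to a total
derivative the density is a nonnegative quadratic form in `f = -v'' - (1 - U²) v` and
`g = U v' - U' v`, the Wronskian of `U` and `v`. -/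
theorem IsProfile.integral_imagDensity_nonneg (h : IsProfile r U W) (hr : 0 < r)
    (hr' : r ≤ 1 / 100) (hd : d ^ 2 ≤ 2 * (1 - 10 * r)) {v v₁ v₂ : ℝ → ℝ}
    (hv : IsH1 v v₁) (hv₁ : IsH1 v₁ v₂) :
    0 ≤ ∫ x, imagDensity (1 - r ^ 2) (2 + r * d) (U x) (W x) (v x) (v₁ x) (v₂ x) := by
  have hU := h.bddC1
  have hW := h.bddC1_deriv
  have hI := h.bddC1_inv_wronskian hr hr'
  have k := BddC1.const
  have hUW := hU.mul hW
  -- `hA`, `hB`, `hC` carry the coefficients of v², v v', v'². Their terms without d produce f² +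
  -- g²; those with r d remove the pole of -r d g²/U²; those with d²/(2 r²) sum to -d²/(2 r²) U U'
  -- g².
  have hA := (hUW.add ((k (-(r * d))).mul ((hUW.mul ((k 1).add ((k (-1)).mul
    (hU.mul hU)))).mul hI))).add ((k (-(d ^ 2 / (2 * r ^ 2)))).mul (hUW.mul (hW.mul hW)))
  have hB := (((k (-2)).add ((k 2).mul (hU.mul hU))).add ((k (-2 * (r * d))).mul
    ((hW.mul hW).mul hI))).add ((k (2 * (d ^ 2 / (2 * r ^ 2)))).mul (hUW.mul hUW))
  have hC := ((k (r * d)).mul (hUW.mul hI)).add ((k (-(d ^ 2 / (2 * r ^ 2)))).mul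
    (hUW.mul (hU.mul hU)))
  refine integral_nonneg_of_null_lagrangian hA hB hC hv hv₁
    (h.integrable_imagDensity _ _ hv hv₁) fun x => ?_
  have hdisc := imag_discriminant hr hr' hd (h.sq_le x) (h.energy x)
  -- The first integral eliminates 𝓔² from the density. The final identity then holds for
  -- independent values of U, U', r d and d²/(2 r²), which are generalized below.
  have hE : (1 - r ^ 2) ^ 2 = (1 - U x ^ 2) ^ 2 - 2 * W x ^ 2 := by linarith [h.energy x]
  have hD : W x ^ 2 + U x ^ 2 - U x ^ 4 ≠ 0 := by
    obtain ⟨Y, Z, Δ, -, -, h3, -, -, -, -, hΔ, -, -⟩ :=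
      orbit_rescaled hr hr' (h.sq_le x) (h.energy x)
    rw [h3]; positivity
  refine (sq_add_two_mul_add_nonneg hdisc (-v₂ x - (1 - U x ^ 2) * v x)
    (U x * v₁ x - W x * v x)).trans_eq ?_
  simp only [imagDensity]
  rw [hE]
  generalize d ^ 2 / (2 * r ^ 2) = l
  generalize r * d = δ
  rw [show W x * W x + U x * U x + (-1) * (U x * U x * (U x * U x)) =
    W x ^ 2 + U x ^ 2 - U x ^ 4 by ring]
  generalize U x = p at *
  generalize W x = q at *
  field_simp
  ring

/-- Nonnegativity of the second variation on real perturbations. Up to a total derivative the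
density is a nonnegative quadratic form in
`F = -u'' - U U' / (1 - U²) u' - (1 - 2 U²) u` and `G = U' / (1 - U²) u' + U u`. -/
theorem IsProfile.integral_realDensity_nonneg (h : IsProfile r U W) (hr : 0 < r)
    (hr' : r ≤ 1 / 100) (hd : d ^ 2 ≤ 2 * (1 - 10 * r)) {v v₁ v₂ : ℝ → ℝ}
    (hv : IsH1 v v₁) (hv₁ : IsH1 v₁ v₂) :
    0 ≤ ∫ x, realDensity (1 - r ^ 2) (2 + r * d) (U x) (W x) (v x) (v₁ x) (v₂ x) := by
  have hU := h.bddC1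
  have hW := h.bddC1_deriv
  have hI := h.bddC1_inv_wronskian hr hr'
  have hK := h.bddC1_inv_one_sub_sq hr hr'
  have k := BddC1.const
  have hUW := hU.mul hW
  have hη := hW.mul hK
  -- Here (1 - U²) G is the Wronskian of U' and u, and G' = (-U' F + U U' G)/(1 - U²). The terms
  -- with d²/(2 r²) sum to d²/(2 r²) U U' G². Modulo derivatives, the r d part of the density is -r
  -- d (1 - U²)² G²/U'²; the terms with r d remove its pole at the zeros of U'.
  have hA := (((k 4).mul hUW).add ((k (r * d)).mul ((hUW.mul ((k 1).add ((k (-1)).mul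
    (hU.mul hU)))).mul hI))).add ((k (d ^ 2 / (2 * r ^ 2))).mul (hUW.mul (hU.mul hU)))
  have hB := (((k (-2)).add ((k 4).mul (hU.mul hU))).add ((k (-2 * (r * d))).mul
    (((hU.mul hU).mul ((k 1).add ((k (-1)).mul (hU.mul hU)))).mul hI))).add
    ((k (2 * (d ^ 2 / (2 * r ^ 2)))).mul (hUW.mul (hU.mul hη)))
  have hC := (((k (-1)).mul (hU.mul hη)).add ((k (-(r * d))).mul (hUW.mul hI))).add
    ((k (d ^ 2 / (2 * r ^ 2))).mul (hUW.mul (hη.mul hη)))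
  refine integral_nonneg_of_null_lagrangian hA hB hC hv hv₁
    (h.integrable_realDensity _ _ hv hv₁) fun x => ?_
  have hdisc := real_discriminant hr hr' hd (h.sq_le x) (h.energy x)
  have hE : (1 - r ^ 2) ^ 2 = (1 - U x ^ 2) ^ 2 - 2 * W x ^ 2 := by linarith [h.energy x]
  have hD : W x ^ 2 + U x ^ 2 - U x ^ 4 ≠ 0 := by
    obtain ⟨Y, Z, Δ, -, -, h3, -, -, -, -, hΔ, -, -⟩ :=
      orbit_rescaled hr hr' (h.sq_le x) (h.energy x)
    rw [h3]; positivity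
  have hb : 1 - U x ^ 2 ≠ 0 := by nlinarith [h.sq_le x]
  refine (sq_add_two_mul_add_nonneg hdisc
    (-v₂ x - U x * W x / (1 - U x ^ 2) * v₁ x - (1 - 2 * U x ^ 2) * v x)
    (W x / (1 - U x ^ 2) * v₁ x + U x * v x)).trans_eq ?_
  simp only [realDensity]
  rw [hE]
  generalize d ^ 2 / (2 * r ^ 2) = l
  generalize r * d = δ
  rw [show W x * W x + U x * U x + (-1) * (U x * U x * (U x * U x)) =
    W x ^ 2 + U x ^ 2 - U x ^ 4 by ring, show 1 + (-1) * (U x * U x) = 1 - U x ^ 2 by ring]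
  generalize U x = p at *
  generalize W x = q at *
  field_simp
  ring

end Profile

/-! ### From the ε-derivative to the quadratic forms -/

/-- At fixed x the density is a polynomial in ε, of degree six because of |ψ|⁶, so its second
derivative at 0 is read off from one coefficient. -/
theorem iteratedDeriv_two_sextic (c₀ c₁ c₂ c₃ c₄ c₅ c₆ : ℝ) :
    iteratedDeriv 2 (fun ε : ℝ => c₀ + c₁ * ε + c₂ * ε ^ 2 + c₃ * ε ^ 3 + c₄ * ε ^ 4 + c₅ * ε ^ 5
      + c₆ * ε ^ 6) 0 = 2 * c₂ := by
  let P : Polynomial ℝ := .C c₀ + .C c₁ * .X + .C c₂ * .X ^ 2 + .C c₃ * .X ^ 3 + .C c₄ * .X ^ 4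
    + .C c₅ * .X ^ 5 + .C c₆ * .X ^ 6
  have hP : (fun ε : ℝ => c₀ + c₁ * ε + c₂ * ε ^ 2 + c₃ * ε ^ 3 + c₄ * ε ^ 4 + c₅ * ε ^ 5
      + c₆ * ε ^ 6) = fun ε => P.eval ε := by
    funext ε; simp [P]
  have hd : deriv (fun ε => P.eval ε) = fun ε => P.derivative.eval ε := by
    funext ε; exact P.deriv
  rw [hP, iteratedDeriv_succ, iteratedDeriv_one, hd, Polynomial.deriv]
  simp [P, Polynomial.derivative_pow]
  ring

/-- The second variation decouples into its values on the real and imaginary parts. -/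
theorem secondVariationDensity_eq (𝓔 c : ℝ) (w w₁ w₂ : ℝ → ℂ) (x : ℝ) :
    secondVariationDensity 𝓔 c w w₁ w₂ x =
      2 * (realDensity 𝓔 c (profile 𝓔 x) (deriv (profile 𝓔) x) (w x).re (w₁ x).re (w₂ x).re
        + imagDensity 𝓔 c (profile 𝓔 x) (deriv (profile 𝓔) x) (w x).im (w₁ x).im (w₂ x).im) := by
  unfold secondVariationDensity
  generalize profile 𝓔 x = U
  generalize deriv (profile 𝓔) x = W
  generalize deriv (deriv (profile 𝓔)) x = X
  obtain ⟨u, v⟩ := w x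
  obtain ⟨u₁, v₁⟩ := w₁ x
  obtain ⟨u₂, v₂⟩ := w₂ x
  -- The pairs n, m, R are the coefficients of ε and ε² in |ψ|², |ψ_x|² and Re(ψ̄ ψ_x). The value X
  -- of the second derivative enters only the orders 0 and 1, so it disappears from the result.
  have key : ∀ (n₁ n₂ m₁ m₂ R₁ R₂ κ : ℝ), n₁ = 2 * U * u → n₂ = u ^ 2 + v ^ 2 →
      m₁ = 2 * W * u₁ → m₂ = u₁ ^ 2 + v₁ ^ 2 → R₁ = U * u₁ + W * u → R₂ = u * u₁ + v * v₁ →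
      κ = 1 / 2 * (3 - 𝓔 ^ 2) →
      (fun ε : ℝ => lambdaDensity 𝓔 c ((U : ℂ) + ε • (⟨u, v⟩ : ℂ)) ((W : ℂ) + ε • (⟨u₁, v₁⟩ : ℂ))
        ((X : ℂ) + ε • (⟨u₂, v₂⟩ : ℂ))) =
      fun ε : ℝ => (X ^ 2 + 3 * U ^ 2 * W ^ 2 + 2 * (U * W) ^ 2 + 1 / 2 * U ^ 6 - κ * U ^ 2
          - c * (W ^ 2 + 1 / 2 * (1 - U ^ 2) ^ 2))
        + (2 * X * u₂ + 3 * (U ^ 2 * m₁ + n₁ * W ^ 2) + 4 * (U * W) * R₁ + 3 / 2 * U ^ 4 * n₁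
          - κ * n₁ - c * (m₁ - (1 - U ^ 2) * n₁)) * ε
        + (u₂ ^ 2 + v₂ ^ 2 + 3 * (U ^ 2 * m₂ + n₁ * m₁ + n₂ * W ^ 2)
          + 2 * (R₁ ^ 2 + 2 * (U * W) * R₂) + 3 / 2 * (U ^ 4 * n₂ + U ^ 2 * n₁ ^ 2) - κ * n₂
          - c * (m₂ + 1 / 2 * n₁ ^ 2 - (1 - U ^ 2) * n₂)) * ε ^ 2
        + (3 * (n₁ * m₂ + n₂ * m₁) + 4 * R₁ * R₂ + 1 / 2 * (n₁ ^ 3 + 6 * U ^ 2 * n₁ * n₂)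
          - c * (n₁ * n₂)) * ε ^ 3
        + (3 * n₂ * m₂ + 2 * R₂ ^ 2 + 3 / 2 * (U ^ 2 * n₂ ^ 2 + n₁ ^ 2 * n₂)
          - c / 2 * n₂ ^ 2) * ε ^ 4
        + (3 / 2 * n₁ * n₂ ^ 2) * ε ^ 5 + (1 / 2 * n₂ ^ 3) * ε ^ 6 := by
    rintro n₁ n₂ m₁ m₂ R₁ R₂ κ rfl rfl rfl rfl rfl rfl rfl
    funext ε
    have h6 : ∀ z : ℂ, ‖z‖ ^ 6 = (‖z‖ ^ 2) ^ 3 := fun z => by ring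
    simp only [lambdaDensity, actionDensity, higherDensity, chargeDensity, energyDensity, h6,
      Complex.sq_norm, Complex.normSq_apply, Complex.add_re, Complex.add_im, Complex.mul_re,
      Complex.conj_re, Complex.conj_im, Complex.smul_re, Complex.smul_im, Complex.ofReal_re,
      Complex.ofReal_im, smul_eq_mul]
    ring
  rw [key _ _ _ _ _ _ _ rfl rfl rfl rfl rfl rfl rfl, iteratedDeriv_two_sextic]
  simp only [realDensity, imagDensity]
  ring

/-- Real-linear images of functions in `H¹(ℝ; ℂ)` are in `H¹(ℝ; ℝ)`. -/
theorem HasWeakDeriv.isH1 {w w₁ : ℝ → ℂ} (h : HasWeakDeriv w w₁) (hw : MemLp w 2 volume)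
    (hw₁ : MemLp w₁ 2 volume) (L : ℂ →L[ℝ] ℝ) : IsH1 (fun x => L (w x)) (fun x => L (w₁ x)) := by
  refine ⟨L.comp_memLp' hw, L.comp_memLp' hw₁, fun φ hφ hφc => ?_⟩
  have i1 : Integrable fun x => deriv φ x • w x :=
    (hw.locallyIntegrable (by norm_num)).integrable_smul_left_of_hasCompactSupport
      (hφ.continuous_deriv (by simp)) hφc.deriv
  have i2 : Integrable fun x => φ x • w₁ x :=
    (hw₁.locallyIntegrable (by norm_num)).integrable_smul_left_of_hasCompactSupport
      hφ.continuous hφc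
  have := congrArg L (h φ hφ hφc)
  rw [map_neg, ← L.integral_comp_comm i1, ← L.integral_comp_comm i2] at this
  simpa only [map_smul, smul_eq_mul] using this

/-- Nonnegativity of the second variation for `c = 2 + r d`, where `r = √(1 - 𝓔)` and `d²` is
smaller than `2` by a multiple of `r`. -/
theorem secondVariation_nonneg {r d : ℝ} (hr : 0 < r) (hr' : r ≤ 1 / 100)
    (hd : d ^ 2 ≤ 2 * (1 - 10 * r)) {w w₁ w₂ : ℝ → ℂ} (hw : IsH2 w w₁ w₂) :
    Integrable (secondVariationDensity (1 - r ^ 2) (2 + r * d) w w₁ w₂) ∧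
      0 ≤ secondVariation (1 - r ^ 2) (2 + r * d) w w₁ w₂ := by
  obtain ⟨W, hW₁, hW₂, hW₃, hW₄⟩ := profile_ode (𝓔 := 1 - r ^ 2) (by nlinarith) (by nlinarith)
  have hder : deriv (profile (1 - r ^ 2)) = W := funext fun x => (hW₁ x).deriv
  have hprof : IsProfile r (profile (1 - r ^ 2)) W :=
    ⟨hW₁, hW₂, hW₃, fun x => by linarith [hW₄ x]⟩
  have hre := hw.weak_fst.isH1 hw.memLp hw.memLp_fst Complex.reCLM
  have hre' := hw.weak_snd.isH1 hw.memLp_fst hw.memLp_snd Complex.reCLM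
  have him := hw.weak_fst.isH1 hw.memLp hw.memLp_fst Complex.imCLM
  have him' := hw.weak_snd.isH1 hw.memLp_fst hw.memLp_snd Complex.imCLM
  have iR := hprof.integrable_realDensity (1 - r ^ 2) (2 + r * d) hre hre'
  have iI := hprof.integrable_imagDensity (1 - r ^ 2) (2 + r * d) him him'
  have pR := hprof.integral_realDensity_nonneg hr hr' hd hre hre'
  have pI := hprof.integral_imagDensity_nonneg hr hr' hd him him'
  simp only [Complex.reCLM_apply, Complex.imCLM_apply] at iR iI pR pI
  have e := funext (secondVariationDensity_eq (1 - r ^ 2) (2 + r * d) w w₁ w₂)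
  rw [hder] at e
  rw [secondVariation, e]
  refine ⟨(iR.fun_add iI).const_mul 2, ?_⟩
  rw [integral_const_mul, integral_add iR iI]
  linarith

end CnoidalNLS

end

/-! ### Choice of the interval of admissible c -/

theorem proposition1 :
    ∃ 𝓔₀ ∈ Set.Ioo (0 : ℝ) 1, ∃ cminus cplus : ℝ → ℝ,
      (∀ 𝓔 ∈ Set.Ioo 𝓔₀ 1,
        1 < cminus 𝓔 ∧ cminus 𝓔 < 2 ∧ 2 < cplus 𝓔 ∧ cplus 𝓔 < 3 ∧
        ∀ c ∈ Set.Ioo (cminus 𝓔) (cplus 𝓔), ∀ w w₁ w₂ : ℝ → ℂ, CnoidalNLS.IsH2 w w₁ w₂ →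
          MeasureTheory.Integrable (CnoidalNLS.secondVariationDensity 𝓔 c w w₁ w₂) ∧
          0 ≤ CnoidalNLS.secondVariation 𝓔 c w w₁ w₂) ∧
      Asymptotics.IsBigO (nhdsWithin 1 (Set.Iio 1))
        (fun 𝓔 : ℝ => cminus 𝓔 - (2 - Real.sqrt (2 * (1 - 𝓔)))) (fun 𝓔 : ℝ => 1 - 𝓔) ∧
      Asymptotics.IsBigO (nhdsWithin 1 (Set.Iio 1))
        (fun 𝓔 : ℝ => cplus 𝓔 - (2 + Real.sqrt (2 * (1 - 𝓔)))) (fun 𝓔 : ℝ => 1 - 𝓔) := by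
  -- The threshold encodes r < 1/100. The correction 20 (1 - 𝓔) = 20 r² gives |d| ≤ √2 - 20 r, hence
  -- d² ≤ 2 - 40 √2 r + 400 r² ≤ 2 (1 - 10 r).
  refine ⟨1 - 1 / 10000, ⟨by norm_num, by norm_num⟩,
    fun 𝓔 => 2 - Real.sqrt (2 * (1 - 𝓔)) + 20 * (1 - 𝓔),
    fun 𝓔 => 2 + Real.sqrt (2 * (1 - 𝓔)) - 20 * (1 - 𝓔), ?_, ?_, ?_⟩
  · rintro 𝓔 ⟨h0, h1⟩
    obtain ⟨r, hr, hr2⟩ : ∃ r : ℝ, 0 < r ∧ r ^ 2 = 1 - 𝓔 :=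
      ⟨Real.sqrt (1 - 𝓔), Real.sqrt_pos.2 (by linarith), Real.sq_sqrt (by linarith)⟩
    have hE : 𝓔 = 1 - r ^ 2 := by linarith
    subst hE
    have hr' : r < 1 / 100 := by
      refine lt_of_pow_lt_pow_left₀ 2 (by norm_num) ?_
      linarith
    have hs : Real.sqrt (2 * (1 - (1 - r ^ 2))) = Real.sqrt 2 * r := by
      rw [sub_sub_cancel, Real.sqrt_mul (by norm_num), Real.sqrt_sq hr.le]
    have hs2 : Real.sqrt 2 ^ 2 = 2 := Real.sq_sqrt (by norm_num)
    have hsl : 1.4 < Real.sqrt 2 := Real.lt_sqrt_of_sq_lt (by norm_num)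
    have hsu : Real.sqrt 2 < 1.5 := (Real.sqrt_lt' (by norm_num)).2 (by norm_num)
    simp only [hs]
    generalize Real.sqrt 2 = s at *
    have hpos : 20 * r ^ 2 < s * r := by nlinarith
    have hsmall : s * r < 1 := by nlinarith
    have hr2' : 0 < r ^ 2 := by positivity
    refine ⟨by linarith, by linarith, by linarith, by linarith, ?_⟩
    rintro c ⟨hc1, hc2⟩ w w₁ w₂ hw
    have hc : c = 2 + r * ((c - 2) / r) := by field_simp; ring
    rw [hc]
    refine CnoidalNLS.secondVariation_nonneg hr hr'.le ?_ hw
    have hd : |(c - 2) / r| ≤ s - 20 * r := by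
      rw [abs_div, abs_of_pos hr, div_le_iff₀ hr, abs_le]
      constructor <;> nlinarith
    have h2 : ((c - 2) / r) ^ 2 ≤ (s - 20 * r) ^ 2 := by
      rw [← sq_abs]
      exact pow_le_pow_left₀ (abs_nonneg _) hd 2
    nlinarith
  · refine Asymptotics.IsBigO.of_bound 20 (Filter.Eventually.of_forall fun 𝓔 => ?_)
    rw [add_sub_cancel_left, norm_mul, Real.norm_of_nonneg (by norm_num : (0 : ℝ) ≤ 20)]
  · refine Asymptotics.IsBigO.of_bound 20 (Filter.Eventually.of_forall fun 𝓔 => ?_)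
    rw [sub_right_comm, sub_self, zero_sub, norm_neg, norm_mul,
      Real.norm_of_nonneg (by norm_num : (0 : ℝ) ≤ 20)]
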